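/- A lattice is a finitely generated free $\mathbf Z$-module with a symmetric $\mathbf Z$-valued bilinear form, $\cong$ denotes isometry, and $\oplus$ denotes the orthogonal direct sum. An embedding of lattices (an injective form-preserving homomorphism) is primitive if its cokernel is torsion free. Let $U$ be the hyperbolic plane, $E_8(-1)$ the negative definite $E_8$ lattice, and $\Lambda_{K3}=U\oplus U\oplus U\oplus E_8(-1)\oplus E_8(-1)$. For $b,c\in\mathbf Z$ let $\Lambda_{b,c}$ be $\mathbf Z^2$ with Gram matrix $\begin{pmatrix}0&b\\ b&2c\end{pmatrix}$, and let $\Gamma_{b,c}=\Lambda_{b,c}\oplus U\oplus E_8(-1)\oplus E_8(-1)$. 1. Let $b,c\in\mathbf Z$ with $b\neq 0$. For every primitive embedding $i:\Gamma_{b,c}\hookrightarrow\Lambda_{K3}$ there is a non-zero integer $a$, coprime to $b$, such that $i(\Gamma_{b,c})^\perp\cong\Lambda_{b,-a^2c}$. Conversely, for every non-zero integer $a$ with $\gcd(b,ac)=\gcd(b,c)$ (in particular for every non-zero $a$ coprime to $b$) there is a primitive embedding $i:\Gamma_{b,c}\hookrightarrow\Lambda_{K3}$ such that $i(\Gamma_{b,c})^\perp\cong\Lambda_{b,-a^2c}$.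 2. Let $b,c\in\mathbf Z$ with $b\ne 0$. Then $\Lambda_{b,c}\cong\Lambda_{-b,c}$, and $\Lambda_{b,c}\cong\Lambda_{b,c-nb}$ for every $n\in\mathbf Z$, and $\Lambda_{b,c}\cong\Lambda_{b,d}$ for every $d\in\mathbf Z$ with $cd\equiv 1\bmod b$. 3. Let $b,c,d\in\mathbf Z$ with $\gcd(b,c)=1$ and $0\le c<d\le b-1$. Then $\Lambda_{b,c}\cong\Lambda_{b,d}$ if and only if $cd\equiv 1\bmod b$. -/

import Mathlib

namespace K3Lattice

open LinearMap (BilinForm)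

section General

variable {M N : Type*} [AddCommGroup M] [AddCommGroup N]

/-- Two `ℤ`-modules with bilinear forms are isometric: there is a `ℤ`-linear isomorphism between
them that carries one form to the other. -/
def Isometric (B : BilinForm ℤ M) (C : BilinForm ℤ N) : Prop :=
  ∃ e : M ≃ₗ[ℤ] N, ∀ x y : M, C (e x) (e y) = B x y

/-- The orthogonal direct sum of two bilinear forms. -/
def orthSum (B : BilinForm ℤ M) (C : BilinForm ℤ N) : BilinForm ℤ (M × N) :=
  B.comp (LinearMap.fst ℤ M N) (LinearMap.fst ℤ M N) +
    C.comp (LinearMap.snd ℤ M N) (LinearMap.snd ℤ M N)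

/-- An embedding of lattices (an injective form-preserving `ℤ`-linear map) is primitive if the
cokernel is torsion free. -/
def IsPrimitiveEmbedding {B : BilinForm ℤ M} {C : BilinForm ℤ N} (i : B.Isometry C) : Prop :=
  Function.Injective i ∧ Module.IsTorsionFree ℤ (N ⧸ LinearMap.range i.toLinearMap)

/-- The form induced on the orthogonal complement of the image of a form-preserving map. -/
def imagePerp {B : BilinForm ℤ M} {C : BilinForm ℤ N} (i : B.Isometry C) :
    BilinForm ℤ (C.orthogonal (LinearMap.range i.toLinearMap)) :=
  C.restrict (C.orthogonal (LinearMap.range i.toLinearMap))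

end General

/-- The rank two lattice `Λ_{b,c}` with Gram matrix `(0, b; b, 2c)`. -/
def Lam (b c : ℤ) : BilinForm ℤ (Fin 2 → ℤ) :=
  Matrix.toBilin' !![0, b; b, 2 * c]

/-- The hyperbolic plane `U`. -/
def U : BilinForm ℤ (Fin 2 → ℤ) :=
  Matrix.toBilin' !![0, 1; 1, 0]

/-- The negative definite lattice `E₈(-1)`. -/
def negE8 : BilinForm ℤ (Fin 8 → ℤ) :=
  Matrix.toBilin' (-CartanMatrix.E₈)

/-- The lattice `Γ_{b,c} = Λ_{b,c} ⊕ U ⊕ E₈(-1) ⊕ E₈(-1)`. -/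
def Gam (b c : ℤ) :
    BilinForm ℤ ((Fin 2 → ℤ) × (Fin 2 → ℤ) × (Fin 8 → ℤ) × (Fin 8 → ℤ)) :=
  orthSum (Lam b c) (orthSum U (orthSum negE8 negE8))

/-- The K3 lattice `U ⊕ U ⊕ U ⊕ E₈(-1) ⊕ E₈(-1)`. -/
def LamK3 :
    BilinForm ℤ ((Fin 2 → ℤ) × (Fin 2 → ℤ) × (Fin 2 → ℤ) × (Fin 8 → ℤ) × (Fin 8 → ℤ)) :=
  orthSum U (orthSum U (orthSum U (orthSum negE8 negE8)))

end K3Lattice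

/-!
Let `i : Λ_{b,c} ⊕ W → L` be primitive, where `W` is unimodular and `L` is even unimodular of rank
`rank W + 4`. The first basis vector of `Λ_{b,c}` maps to an isotropic vector orthogonal to `W`,
which by unimodularity of `L` and primitivity of `i` extends to a hyperbolic plane orthogonal to
`W`. Splitting off `U ⊕ W` leaves an even unimodular plane which, its discriminant `h² - 4st` being
a unit, is again hyperbolic. In the resulting coordinates `L = U ⊕ U ⊕ W` the embedding sends the
basis of `Λ_{b,c}` to `(1, 0; 0, 0)` and `(ν, b; p, q)` with `c = bν + pq`, and it is primitive
exactly when `gcd (b, p, q) = 1`. Its complement is a lattice of solutions of a linear equation: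
with `g = gcd (b, q)` and `a` inverse to `q / g` modulo `b / g`, it is `Λ_{b,-apg} ≅ Λ_{b,-a²c}`,
and `a` can be chosen coprime to `b`. Conversely, every `a` with `gcd (b, ac) = gcd (b, c)` occurs
for a suitable choice of `ν, p, q`.
-/

namespace K3Lattice

open LinearMap (BilinForm)

section Forms

variable {M N P : Type*} [AddCommGroup M] [AddCommGroup N] [AddCommGroup P]
  {B : BilinForm ℤ M} {C : BilinForm ℤ N} {D : BilinForm ℤ P}

theorem isometric_iff_equivalent : Isometric B C ↔ B.Equivalent C :=
  ⟨fun ⟨e, he⟩ => ⟨{ e with map_app' := he }⟩, fun ⟨e⟩ => ⟨e, fun x y => e.map_app y x⟩⟩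

@[simp]
theorem orthSum_apply (x y : M × N) : orthSum B C x y = B x.1 y.1 + C x.2 y.2 := rfl

theorem mem_orthogonal_range {i : B.Isometry C} {y : N} :
    y ∈ C.orthogonal (LinearMap.range i.toLinearMap) ↔ ∀ x, C (i x) y = 0 := by
  simp [BilinForm.mem_orthogonal_iff]

theorem imagePerp_comp_equivalent (i : B.Isometry C) (Φ : C.IsometryEquiv D) :
    (imagePerp i).Equivalent (imagePerp (Φ.toIsometry.comp i)) := by
  have hmap : (C.orthogonal (LinearMap.range i.toLinearMap)).map (Φ : N ≃ₗ[ℤ] P).toLinearMap =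
      D.orthogonal (LinearMap.range (Φ.toIsometry.comp i).toLinearMap) := by
    ext y
    obtain ⟨x, rfl⟩ := (Φ : N ≃ₗ[ℤ] P).surjective y
    rw [Submodule.mem_map_equiv, LinearEquiv.symm_apply_apply, mem_orthogonal_range,
      mem_orthogonal_range]
    simp
  exact ⟨{ (Φ : N ≃ₗ[ℤ] P).ofSubmodules _ _ hmap with map_app' := fun x y => Φ.map_app y x }⟩

theorem IsPrimitiveEmbedding.exists_leftInverse [Module.Finite ℤ N] {i : B.Isometry C}
    (hi : IsPrimitiveEmbedding i) : ∃ ρ : N →ₗ[ℤ] M, Function.LeftInverse ρ i := by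
  have := hi.2
  have hsurj := Submodule.mkQ_surjective (LinearMap.range i.toLinearMap)
  have hsplit := (LinearMap.exact_map_mkQ_range i.toLinearMap).split_tfae hi.1 hsurj
  obtain ⟨ρ, hρ⟩ := (hsplit.out 0 1).1 (Module.projective_lifting_property _ LinearMap.id hsurj)
  exact ⟨ρ, LinearMap.congr_fun hρ⟩

theorem isPrimitiveEmbedding_of_leftInverse [Module.IsTorsionFree ℤ N] {i : B.Isometry C}
    {ρ : N →ₗ[ℤ] M} (hρ : Function.LeftInverse ρ i) : IsPrimitiveEmbedding i := by
  refine ⟨hρ.injective, Module.IsTorsionFree.of_smul_eq_zero fun n z hz => ?_⟩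
  obtain ⟨y, rfl⟩ := Submodule.mkQ_surjective _ z
  rw [← map_smul, Submodule.mkQ_apply, Submodule.Quotient.mk_eq_zero] at hz
  obtain ⟨x, hx : i x = n • y⟩ := hz
  rw [Submodule.mkQ_apply, Submodule.Quotient.mk_eq_zero, or_iff_not_imp_left]
  intro hn
  refine ⟨ρ y, (smul_right_injective N hn : _) ?_⟩
  change n • i (ρ y) = n • y
  rw [← map_smul, ← map_smul, ← hx, hρ x]

theorem IsPrimitiveEmbedding.comp [Module.Finite ℤ N] [Module.IsTorsionFree ℤ P] {i : B.Isometry C}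
    (hi : IsPrimitiveEmbedding i) (Φ : C.IsometryEquiv D) :
    IsPrimitiveEmbedding (Φ.toIsometry.comp i) := by
  obtain ⟨ρ, hρ⟩ := hi.exists_leftInverse
  refine isPrimitiveEmbedding_of_leftInverse (ρ := ρ ∘ₗ (Φ : N ≃ₗ[ℤ] P).symm.toLinearMap)
    fun x => ?_
  change ρ ((Φ : N ≃ₗ[ℤ] P).symm ((Φ : N ≃ₗ[ℤ] P) (i x))) = x
  rw [LinearEquiv.symm_apply_apply, hρ x]

/-- The isometry `B ⊕ C → D` assembled from isometries of `B` and `C` into `D` with orthogonal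
images. -/
def orthCoprod (i : B.Isometry D) (j : C.Isometry D) (hij : ∀ x y, D (i x) (j y) = 0)
    (hD : D.IsSymm) : (orthSum B C).Isometry D where
  toLinearMap := i.toLinearMap.coprod j.toLinearMap
  map_app' x y := by
    have hji : D (j x.2) (i y.1) = 0 := by rw [hD.eq, hij]
    simp [hij, hji]

@[simp]
theorem orthCoprod_apply (i : B.Isometry D) (j : C.Isometry D) (hij : ∀ x y, D (i x) (j y) = 0)
    (hD : D.IsSymm) (x : M × N) : orthCoprod i j hij hD x = i x.1 + j x.2 := rfl

theorem exists_isometryEquiv_orthSum_shuffle {Q : Type*} [AddCommGroup Q] {E : BilinForm ℤ Q}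
    (Ψ : C.IsometryEquiv E) :
    ∃ Θ : (orthSum B (orthSum C D)).IsometryEquiv (orthSum (orthSum B D) E),
      ∀ x y z, Θ (x, y, z) = ((x, z), Ψ y) := by
  let commuted : (N × P) ≃ₗ[ℤ] P × Q :=
    (LinearEquiv.prodComm ℤ N P).trans ((LinearEquiv.refl ℤ P).prodCongr Ψ.toLinearEquiv)
  refine ⟨{ ((LinearEquiv.refl ℤ M).prodCongr commuted).trans
      (LinearEquiv.prodAssoc ℤ M P Q).symm with map_app' := fun x y => ?_ }, fun x y z => rfl⟩
  change B x.1 y.1 + D x.2.2 y.2.2 + E (Ψ x.2.1) (Ψ y.2.1) = _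
  rw [Ψ.map_app, orthSum_apply, orthSum_apply]
  ring

/-- The isometry from a Gram matrix sending the standard basis to the given vectors. -/
def gramIsometry {ι : Type*} [Fintype ι] [DecidableEq ι] {A : Matrix ι ι ℤ} (t : ι → M)
    (hA : ∀ i j, B (t i) (t j) = A i j) : (Matrix.toBilin' A).Isometry B where
  toLinearMap := Fintype.linearCombination ℤ t
  map_app' x y := by
    change B (∑ i, x i • t i) (∑ j, y j • t j) = _
    simp only [map_sum, map_smul, LinearMap.sum_apply, LinearMap.smul_apply, smul_eq_mul, hA,
      Matrix.toBilin'_apply, Finset.mul_sum]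
    rw [Finset.sum_comm]
    exact Finset.sum_congr rfl fun i _ => Finset.sum_congr rfl fun j _ => by ring

@[simp]
theorem gramIsometry_apply {ι : Type*} [Fintype ι] [DecidableEq ι] {A : Matrix ι ι ℤ} (t : ι → M)
    (hA : ∀ i j, B (t i) (t j) = A i j) (x : ι → ℤ) : gramIsometry t hA x = ∑ i, x i • t i := rfl

theorem injective_of_separatingLeft (hB : B.SeparatingLeft) (i : B.Isometry C) :
    Function.Injective i :=
  (injective_iff_map_eq_zero i).2 fun x hx => hB x fun y => by
    rw [← i.map_app, hx, map_zero, LinearMap.zero_apply]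

theorem equivalent_of_surjective (hB : B.SeparatingLeft) (i : B.Isometry C)
    (hi : Function.Surjective i) : B.Equivalent C :=
  ⟨{ LinearEquiv.ofBijective i.toLinearMap ⟨injective_of_separatingLeft hB i, hi⟩ with
    map_app' := i.map_app }⟩

theorem equivalent_of_span_eq_top {ι : Type*} [Fintype ι] [DecidableEq ι] {A : Matrix ι ι ℤ}
    (hdet : A.det ≠ 0) (t : ι → M) (hA : ∀ i j, B (t i) (t j) = A i j)
    (ht : Submodule.span ℤ (Set.range t) = ⊤) : B.Equivalent (Matrix.toBilin' A) := by
  refine (equivalent_of_surjective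
    (BilinForm.nondegenerate_toBilin'_of_det_ne_zero' A hdet).1 (gramIsometry t hA) ?_).symm
  rw [← Fintype.range_linearCombination, LinearMap.range_eq_top] at ht
  exact ht

theorem equivalent_toBilin' {ι : Type*} [Fintype ι] [DecidableEq ι] {A A' Q : Matrix ι ι ℤ}
    (hQ : IsUnit Q.det) (h : Q.transpose * A' * Q = A) :
    (Matrix.toBilin' A).Equivalent (Matrix.toBilin' A') :=
  ⟨{ Matrix.toLinearEquiv' Q ((Matrix.isUnit_iff_isUnit_det Q).2 hQ).invertible with
     map_app' := fun x y => by
      rw [← h, ← Matrix.toBilin'_comp]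
      rfl }⟩

end Forms

section Unimodular

variable {M N : Type*} [AddCommGroup M] [AddCommGroup N] {B : BilinForm ℤ M} {C : BilinForm ℤ N}

theorem bijective_orthSum_iff : Function.Bijective (orthSum B C) ↔
    Function.Bijective B ∧ Function.Bijective C := by
  have hcoprod : ⇑(orthSum B C) = LinearMap.coprodEquiv ℤ ∘ Prod.map B C := by
    ext x y <;> simp
  rw [hcoprod, (LinearMap.coprodEquiv ℤ).bijective.of_comp_iff', Prod.map_bijective]

theorem isPerfPair_iff_bijective :
    B.IsPerfPair ↔ Function.Bijective B ∧ Function.Bijective B.flip :=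
  ⟨fun h => ⟨h.bijective_left, h.bijective_right⟩, fun h => ⟨h.1, h.2⟩⟩

theorem isPerfPair_orthSum_iff : (orthSum B C).IsPerfPair ↔ B.IsPerfPair ∧ C.IsPerfPair := by
  have hflip : (orthSum B C).flip = orthSum B.flip C.flip := rfl
  rw [isPerfPair_iff_bijective, isPerfPair_iff_bijective, isPerfPair_iff_bijective, hflip,
    bijective_orthSum_iff, bijective_orthSum_iff, and_and_and_comm]

theorem isPerfPair_iff_isUnit_det {ι : Type*} [Fintype ι] [DecidableEq ι]
    (b : Module.Basis ι ℤ M) : B.IsPerfPair ↔ IsUnit (LinearMap.BilinForm.toMatrix b B).det := by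
  have := Module.Free.of_basis b
  have := Module.Finite.of_basis b
  let f := Matrix.toLin b b (LinearMap.BilinForm.toMatrix b B).transpose
  have hf : ⇑B = b.toDualEquiv ∘ f := by
    suffices h : B = b.toDualEquiv.toLinearMap ∘ₗ f from congrArg DFunLike.coe h
    refine b.ext fun i => b.ext fun j => ?_
    simp [f, Matrix.toLin_self, Module.Basis.toDual_apply, LinearMap.BilinForm.toMatrix_apply]
  have hperf : B.IsPerfPair ↔ Function.Bijective B :=
    ⟨fun h => h.bijective_left, fun h => .of_bijective B h⟩
  rw [hperf, hf, b.toDualEquiv.bijective.of_comp_iff', ← Module.End.isUnit_iff,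
    ← LinearMap.isUnit_toMatrix_iff (v₁ := b), LinearMap.toMatrix_toLin,
    Matrix.isUnit_iff_isUnit_det, Matrix.det_transpose]

theorem exists_orthogonal_splitting [B.IsPerfPair] (hC : C.IsSymm) (j : B.Isometry C) :
    ∃ Φ : (orthSum B (imagePerp j)).IsometryEquiv C, ∀ x, Φ x = j x.1 + x.2 := by
  let ι : (imagePerp j).Isometry C := ⟨Submodule.subtype _, fun _ _ => rfl⟩
  have hι : ∀ x y, C (j x) (ι y) = 0 := fun x y => mem_orthogonal_range.1 y.2 x
  let Φ := orthCoprod j ι hι hC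
  have hinj : Function.Injective Φ := (injective_iff_map_eq_zero Φ).2 fun ⟨x, y⟩ hxy => by
    have hx : x = 0 := by
      refine LinearMap.IsPerfPair.bijective_right (p := B) |>.1 (LinearMap.ext fun z => ?_)
      have := congrArg (C (j z)) hxy
      simpa [Φ, hι] using this
    subst hx
    exact congrArg (Prod.mk 0) (Subtype.ext (by simpa [Φ] using hxy : ι y = 0))
  have hsurj : Function.Surjective Φ := fun y => by
    obtain ⟨x, hx⟩ := (LinearMap.IsPerfPair.bijective_right (p := B)).2
      (C.flip y ∘ₗ j.toLinearMap)
    have hy : y - j x ∈ C.orthogonal (LinearMap.range j.toLinearMap) :=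
      mem_orthogonal_range.2 fun z => by
        have hz : B z x = C (j z) y := LinearMap.congr_fun hx z
        rw [map_sub, j.map_app, hz, sub_self]
    exact ⟨(x, ⟨_, hy⟩), add_sub_cancel (j x) y⟩
  exact ⟨{ LinearEquiv.ofBijective Φ.toLinearMap ⟨hinj, hsurj⟩ with map_app' := Φ.map_app },
    fun x => rfl⟩

/-- A unimodular even lattice; unimodularity is encoded as the form being a perfect pairing. -/
structure IsEvenUnimodular (B : BilinForm ℤ M) : Prop where
  isSymm : B.IsSymm
  even : ∀ x, Even (B x x)
  isPerfPair : B.IsPerfPair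

protected theorem IsEvenUnimodular.orthSum (hB : IsEvenUnimodular B) (hC : IsEvenUnimodular C) :
    IsEvenUnimodular (orthSum B C) where
  isSymm := ⟨fun x y => by simp [hB.isSymm.eq x.1, hC.isSymm.eq x.2]⟩
  even x := (hB.even x.1).add (hC.even x.2)
  isPerfPair := isPerfPair_orthSum_iff.2 ⟨hB.isPerfPair, hC.isPerfPair⟩

protected theorem IsEvenUnimodular.imagePerp [B.IsPerfPair] (hC : IsEvenUnimodular C)
    (j : B.Isometry C) : IsEvenUnimodular (imagePerp j) where
  isSymm := ⟨fun x y => hC.isSymm.eq x.1 y.1⟩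
  even x := hC.even x.1
  isPerfPair := by
    obtain ⟨Φ, -⟩ := exists_orthogonal_splitting hC.isSymm j
    have := hC.isPerfPair
    have hΦ : (orthSum B (imagePerp j)).IsPerfPair :=
      .congr C Φ.toLinearEquiv Φ.toLinearEquiv _
        (LinearMap.ext₂ fun x y => Φ.symm.map_app y x)
    exact (isPerfPair_orthSum_iff.1 hΦ).2

theorem even_apply_self_of_span_eq_top (hB : B.IsSymm) {S : Set M}
    (hS : Submodule.span ℤ S = ⊤) (heven : ∀ x ∈ S, Even (B x x)) (x : M) : Even (B x x) := by
  induction hS.symm ▸ Submodule.mem_top (x := x) using Submodule.span_induction with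
  | mem x hx => exact heven x hx
  | zero => simp
  | add x y _ _ hx hy =>
    have hpolar : B (x + y) (x + y) = B x x + B y y + 2 * B x y := by
      simp only [map_add, LinearMap.add_apply, hB.eq y x]
      ring
    exact hpolar ▸ (hx.add hy).add (even_two_mul _)
  | smul n x _ hx => simpa using (hx.mul_left n).mul_left n

theorem isEvenUnimodular_toBilin' {ι : Type*} [Fintype ι] [DecidableEq ι] {A : Matrix ι ι ℤ}
    (hA : A.IsSymm) (hdiag : ∀ i, Even (A i i)) (hdet : IsUnit A.det) :
    IsEvenUnimodular (Matrix.toBilin' A) where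
  isSymm := Matrix.isSymm_toBilin'_iff_isSymm.2 hA
  even := even_apply_self_of_span_eq_top (Matrix.isSymm_toBilin'_iff_isSymm.2 hA)
    (Pi.basisFun ℤ ι).span_eq (by simpa using hdiag)
  isPerfPair := by
    have hgram : LinearMap.BilinForm.toMatrix (Pi.basisFun ℤ ι) (Matrix.toBilin' A) = A := by
      ext i j
      simp [LinearMap.BilinForm.toMatrix_apply]
    rwa [isPerfPair_iff_isUnit_det (Pi.basisFun ℤ ι), hgram]

theorem isEvenUnimodular_U : IsEvenUnimodular U :=
  isEvenUnimodular_toBilin' (by decide) (by decide) (by decide)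

theorem isEvenUnimodular_negE8 : IsEvenUnimodular negE8 :=
  isEvenUnimodular_toBilin' (by decide) (by decide)
    (by simp [Matrix.det_neg, CartanMatrix.E₈_det])

end Unimodular

section Hyperbolic

variable {M N P : Type*} [AddCommGroup M] [AddCommGroup N] [AddCommGroup P]
  {B : BilinForm ℤ M} {C : BilinForm ℤ N} {W : BilinForm ℤ P}

theorem U_apply (x y : Fin 2 → ℤ) : U x y = x 0 * y 1 + x 1 * y 0 := by
  simp [U, Matrix.toBilin'_apply, Fin.sum_univ_two]

theorem Lam_apply (b c : ℤ) (x y : Fin 2 → ℤ) :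
    Lam b c x y = b * (x 0 * y 1 + x 1 * y 0) + 2 * c * (x 1 * y 1) := by
  simp only [Lam, Matrix.toBilin'_apply, Fin.sum_univ_two, Matrix.of_apply, Matrix.cons_val_zero,
    Matrix.cons_val_one, Matrix.cons_val_fin_one]
  ring

theorem exists_isometry_U (hC : C.IsSymm) (heven : ∀ x, Even (C x x)) {e v : N}
    (he : C e e = 0) (hev : C e v = 1) :
    ∃ (k : ℤ) (j : U.Isometry C), ∀ x, j x = x 0 • e + x 1 • (v - k • e) := by
  obtain ⟨k, hk⟩ := heven v
  have hve : C v e = 1 := by rw [hC.eq, hev]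
  refine ⟨k, gramIsometry ![e, v - k • e] fun i j => ?_, fun x => ?_⟩
  · fin_cases i <;> fin_cases j <;> simp [he, hev, hve, hk]
  · exact (gramIsometry_apply _ _ x).trans (Fin.sum_univ_two _)

theorem exists_isCoprime_isotropic {s w t : ℤ} (h : IsUnit (w ^ 2 - 4 * s * t)) :
    ∃ x y, IsCoprime x y ∧ s * x ^ 2 + w * x * y + t * y ^ 2 = 0 := by
  obtain ⟨m, rfl, hst⟩ : ∃ m, w = 2 * m + 1 ∧ s * t = m * (m + 1) := by
    obtain ⟨m, rfl | rfl⟩ := Int.even_or_odd' w <;> ring_nf at h <;>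
      obtain h | h := Int.isUnit_iff.1 h
    · omega
    · omega
    · exact ⟨m, rfl, by linarith⟩
    · omega
  obtain rfl | hs := eq_or_ne s 0
  · exact ⟨1, 0, isCoprime_one_left, by ring⟩
  obtain ⟨s', m', hs', hm', hunit⟩ := extract_gcd s m
  have hts : t * s' = m' * (m + 1) := by
    refine mul_left_cancel₀ (left_ne_zero_of_mul (hs' ▸ hs)) ?_
    linear_combination hst - t * hs' + (m + 1) * hm'
  refine ⟨-m', s', ((gcd_isUnit_iff s' m').1 hunit).symm.neg_left, ?_⟩
  linear_combination s' * hts + m' ^ 2 * hs' - m' * s' * hm'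

theorem IsEvenUnimodular.exists_isotropic [Module.Free ℤ M] [Module.Finite ℤ M]
    (hB : IsEvenUnimodular B) (hrank : Module.finrank ℤ M = 2) :
    ∃ e v, B e e = 0 ∧ B e v = 1 := by
  let β := Module.finBasisOfFinrankEq ℤ M hrank
  obtain ⟨s, hs⟩ := (hB.even (β 0)).two_dvd
  obtain ⟨t, ht⟩ := (hB.even (β 1)).two_dvd
  have hsymm : B (β 1) (β 0) = B (β 0) (β 1) := hB.isSymm.eq _ _
  have hdisc : IsUnit (B (β 0) (β 1) ^ 2 - 4 * s * t) := by
    have hdet := ((isPerfPair_iff_isUnit_det β).1 hB.isPerfPair).neg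
    rw [Matrix.det_fin_two] at hdet
    simp only [LinearMap.BilinForm.toMatrix_apply, hs, ht, hsymm] at hdet
    ring_nf at hdet ⊢
    exact hdet
  obtain ⟨x, y, ⟨u, v, huv⟩, hxy⟩ := exists_isCoprime_isotropic hdisc
  obtain ⟨d, hd⟩ := hB.isPerfPair.bijective_left.2 (u • β.coord 0 + v • β.coord 1)
  refine ⟨x • β 0 + y • β 1, d, ?_, ?_⟩
  · simp only [map_add, map_smul, LinearMap.add_apply, LinearMap.smul_apply, smul_eq_mul, hs, ht,
      hsymm]
    linear_combination 2 * hxy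
  · rw [← hB.isSymm.eq, hd]
    simpa using huv

theorem IsEvenUnimodular.equivalent_U [Module.Free ℤ M] [Module.Finite ℤ M]
    (hB : IsEvenUnimodular B) (hrank : Module.finrank ℤ M = 2) : U.Equivalent B := by
  obtain ⟨e, v, he, hev⟩ := hB.exists_isotropic hrank
  obtain ⟨k, j, -⟩ := exists_isometry_U hB.isSymm hB.even he hev
  have := isEvenUnimodular_U.isPerfPair
  obtain ⟨Φ, hΦ⟩ := exists_orthogonal_splitting hB.isSymm j
  have hzero : Subsingleton (B.orthogonal (LinearMap.range j.toLinearMap)) := by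
    have hsum := Φ.toLinearEquiv.finrank_eq
    rw [Module.finrank_prod, Module.finrank_fin_fun, hrank] at hsum
    exact (Module.finrank_zero_iff (R := ℤ)).1 (by omega)
  refine equivalent_of_surjective (fun x hx => ?_) j fun y => ?_
  · exact LinearMap.IsPerfPair.bijective_left (p := U) |>.1 (by ext; simp [hx])
  · obtain ⟨⟨x, n⟩, rfl⟩ := Φ.toLinearEquiv.surjective y
    exact ⟨x, by simp [hΦ, Subsingleton.elim n 0]⟩

theorem IsEvenUnimodular.exists_hyperbolic_splitting [Module.Free ℤ N] [Module.Finite ℤ N]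
    [Module.Free ℤ P] [Module.Finite ℤ P] (hC : IsEvenUnimodular C) [W.IsPerfPair]
    (hrank : Module.finrank ℤ N = Module.finrank ℤ P + 4) (j : (orthSum U W).Isometry C) :
    ∃ Φ : (orthSum U (orthSum U W)).IsometryEquiv C,
      ∀ x Y, Φ (x, 0, Y) = j (x, Y) := by
  have := isEvenUnimodular_U.isPerfPair
  have : (orthSum U W).IsPerfPair := isPerfPair_orthSum_iff.2 ⟨inferInstance, inferInstance⟩
  obtain ⟨Φ, hΦ⟩ := exists_orthogonal_splitting hC.isSymm j
  have hrank' : Module.finrank ℤ (C.orthogonal (LinearMap.range j.toLinearMap)) = 2 := by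
    have hsum := Φ.toLinearEquiv.finrank_eq
    rw [Module.finrank_prod, Module.finrank_prod, Module.finrank_fin_fun, hrank] at hsum
    omega
  obtain ⟨Ψ⟩ := (hC.imagePerp j).equivalent_U hrank'
  obtain ⟨Θ, hΘ⟩ := exists_isometryEquiv_orthSum_shuffle (B := U) (D := W) Ψ
  exact ⟨Θ.trans Φ, fun x Y => (hΦ _).trans (by simp [hΘ])⟩

end Hyperbolic

section RankTwo

theorem equivalent_Lam_of_gram {b b' c d x y z w : ℤ} (hdet : IsUnit (x * w - z * y))
    (h₁₁ : y * (b' * x + d * y) = 0) (h₂₂ : w * (b' * z + d * w) = c)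
    (h₁₂ : b' * (x * w + y * z) + 2 * d * (y * w) = b) : (Lam b c).Equivalent (Lam b' d) := by
  refine equivalent_toBilin' (Q := !![x, z; y, w]) (by rwa [Matrix.det_fin_two_of]) ?_
  ext i j
  fin_cases i <;> fin_cases j <;>
    simp only [Fin.zero_eta, Fin.mk_one, Matrix.mul_apply, Matrix.transpose_apply, Matrix.of_apply,
      Matrix.cons_val', Matrix.cons_val_zero, Matrix.cons_val_one, Matrix.cons_val_fin_one,
      Fin.sum_univ_two]
  · linear_combination 2 * h₁₁
  · linear_combination h₁₂
  · linear_combination h₁₂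
  · linear_combination 2 * h₂₂

theorem equivalent_Lam_neg (b c : ℤ) : (Lam b c).Equivalent (Lam (-b) c) :=
  equivalent_Lam_of_gram (x := -1) (y := 0) (z := 0) (w := 1) (by simp) (by simp) (by simp)
    (by simp)

theorem equivalent_Lam_sub_mul (b c n : ℤ) : (Lam b c).Equivalent (Lam b (c - n * b)) :=
  equivalent_Lam_of_gram (x := 1) (y := 0) (z := n) (w := 1) (by simp) (by simp) (by ring)
    (by ring)

theorem equivalent_Lam_of_modEq {b c d : ℤ} (h : c ≡ d [ZMOD b]) :
    (Lam b c).Equivalent (Lam b d) := by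
  obtain ⟨n, hn⟩ := h.symm.dvd
  obtain rfl : d = c - n * b := by linear_combination -hn
  exact equivalent_Lam_sub_mul b c n

theorem equivalent_Lam_of_mul_modEq_one {b c d : ℤ} (h : c * d ≡ 1 [ZMOD b]) :
    (Lam b c).Equivalent (Lam b d) := by
  obtain ⟨k, hk⟩ := h.dvd
  refine equivalent_Lam_of_gram (x := -d) (y := b) (z := k) (w := c)
    (Int.isUnit_iff.2 (.inr ?_)) ?_ ?_ ?_
  · linear_combination hk
  · ring
  · linear_combination (-c) * hk
  · linear_combination (-b) * hk

theorem exists_gram_of_equivalent_Lam {b c d : ℤ} (h : (Lam b c).Equivalent (Lam b d)) :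
    ∃ x y z w : ℤ, y * (b * x + d * y) = 0 ∧ w * (b * z + d * w) = c ∧
      b * (x * w + y * z) + 2 * d * (y * w) = b := by
  obtain ⟨e⟩ := h
  have h₁₁ := e.map_app ![1, 0] ![1, 0]
  have h₁₂ := e.map_app ![0, 1] ![1, 0]
  have h₂₂ := e.map_app ![0, 1] ![0, 1]
  rw [Lam_apply, Lam_apply] at h₁₁ h₁₂ h₂₂
  simp only [Matrix.cons_val_zero, Matrix.cons_val_one, Matrix.cons_val_fin_one] at h₁₁ h₁₂ h₂₂
  refine ⟨e ![1, 0] 0, e ![1, 0] 1, e ![0, 1] 0, e ![0, 1] 1, ?_, ?_, ?_⟩ <;> linarith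

theorem equivalent_Lam_iff {b c d : ℤ} (hb : b ≠ 0) (hbc : IsCoprime b c) :
    (Lam b c).Equivalent (Lam b d) ↔ c ≡ d [ZMOD b] ∨ c * d ≡ 1 [ZMOD b] := by
  refine ⟨fun h => ?_, fun h => h.elim equivalent_Lam_of_modEq equivalent_Lam_of_mul_modEq_one⟩
  obtain ⟨x, y, z, w, h₁₁, h₂₂, h₁₂⟩ := exists_gram_of_equivalent_Lam h
  obtain rfl | hy := mul_eq_zero.1 h₁₁
  · left
    have hxw : x * w = 1 := mul_left_cancel₀ hb (by linear_combination h₁₂)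
    have hw : w * w = 1 := Int.isUnit_mul_self (.of_mul_eq_one_right _ hxw)
    exact Int.modEq_iff_dvd.2 ⟨-(w * z), by linear_combination (-d) * hw + h₂₂⟩
  · right
    have hyb : y * (b * z + d * w) = b := by linear_combination h₁₂ - w * hy
    have hyc : y * c = b * w := by linear_combination w * hyb - y * h₂₂
    obtain ⟨k, hk⟩ : b ∣ y := hbc.dvd_of_dvd_mul_right ⟨w, hyc⟩
    have hk1 : k * (b * z + d * w) = 1 :=
      mul_left_cancel₀ hb (by linear_combination hyb - (b * z + d * w) * hk)
    have hkc : k * c = w := mul_left_cancel₀ hb (by linear_combination hyc - c * hk)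
    have hkk : k * k = 1 := Int.isUnit_mul_self (.of_mul_eq_one _ hk1)
    exact Int.modEq_iff_dvd.2 ⟨k * z, by linear_combination c * d * hkk - hk1 - k * d * hkc⟩

end RankTwo

section LamEmbedding

variable {P : Type*} [AddCommGroup P]

/-- The isometry `Λ_{b,c} ⊕ W → U ⊕ U ⊕ W` that is the identity on `W` and sends the basis of
`Λ_{b,c}` to `(1, 0; 0, 0)` and `(ν, b; p, q)`. -/
def lamEmbedding (W : BilinForm ℤ P) {b c : ℤ} (ν p q : ℤ) (hc : c = b * ν + p * q) :
    (orthSum (Lam b c) W).Isometry (orthSum U (orthSum U W)) where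
  toFun z := (![z.1 0 + z.1 1 * ν, z.1 1 * b], ![z.1 1 * p, z.1 1 * q], z.2)
  map_add' z z' := by
    refine Prod.ext ?_ (Prod.ext ?_ rfl) <;> ext k <;> fin_cases k <;>
      simp [add_mul, add_add_add_comm]
  map_smul' n z := by
    refine Prod.ext ?_ (Prod.ext ?_ rfl) <;> ext k <;> fin_cases k <;> simp [mul_add, mul_assoc]
  map_app' z z' := by
    subst hc
    change orthSum U (orthSum U W) (![_, _], ![_, _], _) (![_, _], ![_, _], _) = _
    simp only [orthSum_apply, U_apply, Lam_apply, Matrix.cons_val_zero, Matrix.cons_val_one]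
    ring

variable {W : BilinForm ℤ P} {b c ν p q : ℤ} {hc : c = b * ν + p * q}

theorem lamEmbedding_apply (z : (Fin 2 → ℤ) × P) : lamEmbedding W ν p q hc z =
    (![z.1 0 + z.1 1 * ν, z.1 1 * b], ![z.1 1 * p, z.1 1 * q], z.2) := rfl

theorem eq_lamEmbedding [W.IsPerfPair]
    {i : (orthSum (Lam b c) W).Isometry (orthSum U (orthSum U W))}
    (hi : i (![1, 0], 0) = (![1, 0], 0, 0)) (hiW : ∀ Y, i (0, Y) = (0, 0, Y)) :
    ∃ (ν p q : ℤ) (hc : c = b * ν + p * q), i = lamEmbedding W ν p q hc := by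
  obtain ⟨z, u, Y, hf⟩ : ∃ z u Y, i (![0, 1], 0) = (z, u, Y) := ⟨_, _, _, rfl⟩
  have hY : Y = 0 := by
    refine (LinearMap.IsPerfPair.bijective_left (p := W)).1 (LinearMap.ext fun Z => ?_)
    simpa [hf, hiW, U_apply, Lam_apply] using i.map_app (![0, 1], 0) (0, Z)
  have hz : z 1 = b := by
    simpa [hf, hi, U_apply, Lam_apply] using i.map_app (![0, 1], 0) (![1, 0], 0)
  have hc : c = b * z 0 + u 0 * u 1 := by
    have hff := i.map_app (![0, 1], 0) (![0, 1], 0)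
    simp only [hf, hY, hz, orthSum_apply, U_apply, Lam_apply, Matrix.cons_val_zero,
      Matrix.cons_val_one] at hff
    linarith
  refine ⟨z 0, u 0, u 1, hc, BilinForm.Isometry.ext fun ⟨x, Z⟩ => ?_⟩
  have hx : ((x, Z) : (Fin 2 → ℤ) × P) = x 0 • (![1, 0], 0) + x 1 • (![0, 1], 0) + (0, Z) := by
    refine Prod.ext (funext fun k => ?_) (by simp)
    fin_cases k <;> simp
  rw [hx, map_add, map_add, map_smul, map_smul, hi, hiW, hf, ← hx, lamEmbedding_apply, hY]
  refine Prod.ext ?_ (Prod.ext ?_ (by simp)) <;> ext k <;> fin_cases k <;>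
    simp [-zsmul_eq_mul, Matrix.vecHead, Matrix.vecTail, hz]

theorem isPrimitiveEmbedding_lamEmbedding_iff [Module.Free ℤ P] [Module.Finite ℤ P] :
    IsPrimitiveEmbedding (lamEmbedding W ν p q hc) ↔ ∃ β σ τ : ℤ, β * b + σ * p + τ * q = 1 := by
  constructor
  · intro h
    obtain ⟨ρ, hρ⟩ := h.exists_leftInverse
    let φ : (Fin 2 → ℤ) × (Fin 2 → ℤ) × P →ₗ[ℤ] ℤ :=
      LinearMap.proj 1 ∘ₗ LinearMap.fst ℤ _ _ ∘ₗ ρ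
    have hφ (x : Fin 2 → ℤ) : φ (lamEmbedding W ν p q hc (x, 0)) = x 1 :=
      congrArg (fun z => z.1 1) (hρ (x, 0))
    have he : φ (![1, 0], ![0, 0], 0) = 0 := by simpa [lamEmbedding_apply] using hφ ![1, 0]
    have hf : φ (![ν, b], ![p, q], 0) = 1 := by simpa [lamEmbedding_apply] using hφ ![0, 1]
    refine ⟨φ (![0, 1], ![0, 0], 0), φ (![0, 0], ![1, 0], 0), φ (![0, 0], ![0, 1], 0), ?_⟩
    have hsplit : ((![ν, b], ![p, q], 0) : (Fin 2 → ℤ) × (Fin 2 → ℤ) × P) =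
        ν • (![1, 0], ![0, 0], 0) + b • (![0, 1], ![0, 0], 0) + p • (![0, 0], ![1, 0], 0) +
          q • (![0, 0], ![0, 1], 0) := by
      simp
    rw [hsplit] at hf
    simp only [map_add, map_smul, he, smul_eq_mul] at hf
    linarith
  · rintro ⟨β, σ, τ, h⟩
    let y : (Fin 2 → ℤ) × (Fin 2 → ℤ) × P →ₗ[ℤ] ℤ :=
      LinearMap.coprod (β • LinearMap.proj 1)
        (LinearMap.coprod (σ • LinearMap.proj 0 + τ • LinearMap.proj 1) 0)
    let ρ : (Fin 2 → ℤ) × (Fin 2 → ℤ) × P →ₗ[ℤ] (Fin 2 → ℤ) × P :=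
      (LinearMap.pi ![LinearMap.proj 0 ∘ₗ LinearMap.fst ℤ _ _ - ν • y, y]).prod
        (LinearMap.snd ℤ _ _ ∘ₗ LinearMap.snd ℤ _ _)
    refine isPrimitiveEmbedding_of_leftInverse (ρ := ρ) fun ⟨x, Y⟩ => ?_
    have hy : y (lamEmbedding W ν p q hc (x, Y)) = x 1 := by
      change β * (x 1 * b) + (σ * (x 1 * p) + τ * (x 1 * q) + 0) = x 1
      linear_combination x 1 * h
    refine Prod.ext (funext fun k => ?_) rfl
    fin_cases k
    · change x 0 + x 1 * ν - ν * y (lamEmbedding W ν p q hc (x, Y)) = x 0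
      rw [hy]
      ring
    · exact hy

theorem mem_orthogonal_lamEmbedding [W.IsPerfPair] {z u : Fin 2 → ℤ} {Y : P} :
    (z, u, Y) ∈ (orthSum U (orthSum U W)).orthogonal
        (LinearMap.range (lamEmbedding W ν p q hc).toLinearMap) ↔
      z 1 = 0 ∧ b * z 0 + q * u 0 + p * u 1 = 0 ∧ Y = 0 := by
  rw [mem_orthogonal_range]
  constructor
  · intro h
    have he : z 1 = 0 := by simpa [lamEmbedding_apply, U_apply] using h (![1, 0], 0)
    have hf : b * z 0 + (p * u 1 + q * u 0) = 0 := by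
      simpa [lamEmbedding_apply, U_apply, he] using h (![0, 1], 0)
    have hY : Y = 0 :=
      (LinearMap.IsPerfPair.bijective_right (p := W)).1 <| LinearMap.ext fun Z => by
        simpa [lamEmbedding_apply, U_apply] using h (0, Z)
    exact ⟨he, by linarith, hY⟩
  · rintro ⟨he, hf, rfl⟩ ⟨x, Z⟩
    simp only [lamEmbedding_apply, orthSum_apply, U_apply, he, Matrix.cons_val_zero,
      Matrix.cons_val_one, Matrix.cons_val_fin_one, map_zero]
    linear_combination x 1 * hf

end LamEmbedding

section Arithmetic

theorem exists_isCoprime_modEq {b m r : ℤ} (hb : b ≠ 0) (hm : m ≠ 0) (hr : IsCoprime r m) :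
    ∃ a, a ≠ 0 ∧ IsCoprime a b ∧ a ≡ r [ZMOD m] := by
  obtain ⟨a, hab, ha, har⟩ := Nat.forall_exists_prime_gt_and_zmodEq b.natAbs
    (Int.natAbs_ne_zero.2 hm) (Int.natCast_natAbs m ▸ hr.abs_right)
  refine ⟨a, mod_cast ha.ne_zero, ?_, by simpa [Int.modEq_iff_dvd] using har⟩
  rw [Int.isCoprime_iff_nat_coprime, Int.natAbs_natCast]
  exact Nat.coprime_of_lt_prime (Int.natAbs_ne_zero.2 hb) hab ha

theorem exists_coords_of_linear_relation {b p q a r B g k : ℤ} (hb : b ≠ 0) (hB : b = g * B)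
    (hq : q = g * r) (har : a * r = 1 + k * B) (hgp : IsCoprime g p) {y m n : ℤ}
    (h : b * y + q * m + p * n = 0) :
    ∃ s t : ℤ, y = s * -r + t * (p * k) ∧ m = s * B + t * -(a * p) ∧ n = t * g := by
  subst hB hq
  obtain ⟨hg, hB⟩ := mul_ne_zero_iff.1 hb
  obtain ⟨t, rfl⟩ : g ∣ n := hgp.dvd_of_dvd_mul_left ⟨-(B * y + r * m), by linear_combination h⟩
  have hy : B * y + r * m + p * t = 0 := mul_left_cancel₀ hg (by linear_combination h)
  have hrB : IsCoprime B r := ⟨-k, a, by linear_combination har⟩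
  obtain ⟨s, hs⟩ : B ∣ m + t * (a * p) :=
    hrB.dvd_of_dvd_mul_left ⟨-y + t * p * k, by linear_combination hy + t * p * har⟩
  refine ⟨s, t, mul_left_cancel₀ hB ?_, by linear_combination hs, mul_comm _ _⟩
  linear_combination hy - r * hs + t * p * har

end Arithmetic

section Complement

variable {N P : Type*} [AddCommGroup N] [AddCommGroup P]
  {C : BilinForm ℤ N} {W : BilinForm ℤ P} [W.IsPerfPair] {b c : ℤ}

theorem imagePerp_lamEmbedding_equivalent {ν p q a r B g k : ℤ} {hc : c = b * ν + p * q}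
    (hb : b ≠ 0) (hB : b = g * B) (hq : q = g * r) (har : a * r = 1 + k * B)
    (hgp : IsCoprime g p) :
    (imagePerp (lamEmbedding W ν p q hc)).Equivalent (Lam b (-(a * p * g))) := by
  have hmem {y m n : ℤ} (h : b * y + q * m + p * n = 0) :
      (![y, 0], ![m, n], (0 : P)) ∈ (orthSum U (orthSum U W)).orthogonal
        (LinearMap.range (lamEmbedding W ν p q hc).toLinearMap) :=
    mem_orthogonal_lamEmbedding.2 (by simpa using h)
  have h₁ : b * -r + q * B + p * 0 = 0 := by
    rw [hB, hq]
    ring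
  have h₂ : b * (p * k) + q * -(a * p) + p * g = 0 := by
    rw [hB, hq]
    linear_combination (-p * g) * har
  refine equivalent_of_span_eq_top ?_ ![⟨_, hmem h₁⟩, ⟨_, hmem h₂⟩] (fun i j => ?_) ?_
  · simpa [Matrix.det_fin_two_of] using hb
  · fin_cases i <;> fin_cases j <;> simp [imagePerp, U_apply, hB, mul_comm]
    ring
  · refine Submodule.eq_top_iff'.2 fun ⟨⟨z, u, Y⟩, hx⟩ => ?_
    obtain ⟨he, hf, rfl⟩ := mem_orthogonal_lamEmbedding.1 hx
    obtain ⟨s, t, hz, hu₀, hu₁⟩ := exists_coords_of_linear_relation hb hB hq har hgp hf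
    refine (Submodule.mem_span_range_iff_exists_fun ℤ).2
      ⟨![s, t], Subtype.ext (Prod.ext ?_ (Prod.ext ?_ ?_))⟩
    · ext l
      fin_cases l <;> simp [hz, he]
    · ext l
      fin_cases l <;> simp [hu₀, hu₁]
    · simp

theorem imagePerp_lamEmbedding_equivalent_sq {ν p q a r B g k : ℤ} {hc : c = b * ν + p * q}
    (hb : b ≠ 0) (hB : b = g * B) (hq : q = g * r) (har : a * r = 1 + k * B)
    (hgp : IsCoprime g p) :
    (imagePerp (lamEmbedding W ν p q hc)).Equivalent (Lam b (-(a ^ 2 * c))) := by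
  refine (imagePerp_lamEmbedding_equivalent hb hB hq har hgp).trans
    (equivalent_Lam_of_modEq (Int.modEq_iff_dvd.2 ⟨-(a ^ 2 * ν + a * p * k), ?_⟩))
  rw [hc, hq]
  linear_combination (-(a * p * g)) * har + a * p * k * hB

variable [Module.Free ℤ P] [Module.Finite ℤ P]

theorem IsPrimitiveEmbedding.exists_isometryEquiv_comp_eq_lamEmbedding [Module.Free ℤ N]
    [Module.Finite ℤ N] (hC : IsEvenUnimodular C)
    (hrank : Module.finrank ℤ N = Module.finrank ℤ P + 4)
    {i : (orthSum (Lam b c) W).Isometry C} (hi : IsPrimitiveEmbedding i) :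
    ∃ (Φ : C.IsometryEquiv (orthSum U (orthSum U W))) (ν p q : ℤ) (hc : c = b * ν + p * q),
      Φ.toIsometry.comp i = lamEmbedding W ν p q hc := by
  obtain ⟨ρ, hρ⟩ := hi.exists_leftInverse
  obtain ⟨v, hv⟩ := hC.isPerfPair.bijective_right.2 (LinearMap.proj 0 ∘ₗ LinearMap.fst ℤ _ _ ∘ₗ ρ)
  have hiv : ∀ z, C (i z) v = z.1 0 := fun z =>
    (LinearMap.congr_fun hv (i z)).trans (congrArg (fun z => z.1 0) (hρ z))
  let iW : W.Isometry C := ⟨i.toLinearMap ∘ₗ LinearMap.inr ℤ _ _, fun Y Z => by simp⟩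
  have hiW : ∀ Y, iW Y = i (0, Y) := fun _ => rfl
  have heW : ∀ Y, C (i (![1, 0], 0)) (iW Y) = 0 := fun Y =>
    (i.map_app _ (0, Y)).trans (by simp [Lam_apply])
  have hvW : ∀ Y, C v (iW Y) = 0 := fun Y => by
    rw [← hC.isSymm.eq]
    exact hiv (0, Y)
  obtain ⟨k, jU, hjU⟩ := exists_isometry_U hC.isSymm hC.even (e := i (![1, 0], 0)) (v := v)
    (by simp [Lam_apply]) (by simp [hiv])
  let j := orthCoprod jU iW (fun x Y => by simp [hjU, heW, hvW]) hC.isSymm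
  obtain ⟨Φ, hΦ⟩ := hC.exists_hyperbolic_splitting hrank j
  refine ⟨Φ.symm, eq_lamEmbedding ?_ fun Y => ?_⟩
  · refine Φ.toLinearEquiv.symm_apply_eq.2 ((hΦ _ _).trans ?_).symm
    simp [j, hjU]
  · refine Φ.toLinearEquiv.symm_apply_eq.2 ((hΦ _ _).trans ?_).symm
    simp [j, hiW]

theorem IsPrimitiveEmbedding.exists_imagePerp_equivalent_Lam [Module.Free ℤ N]
    [Module.Finite ℤ N] (hC : IsEvenUnimodular C)
    (hrank : Module.finrank ℤ N = Module.finrank ℤ P + 4) (hb : b ≠ 0)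
    {i : (orthSum (Lam b c) W).Isometry C} (hi : IsPrimitiveEmbedding i) :
    ∃ a, a ≠ 0 ∧ IsCoprime a b ∧ (imagePerp i).Equivalent (Lam b (-(a ^ 2 * c))) := by
  obtain ⟨Φ, ν, p, q, hc, hΦ⟩ := hi.exists_isometryEquiv_comp_eq_lamEmbedding hC hrank
  have hprim := hi.comp Φ
  rw [hΦ] at hprim
  obtain ⟨β, σ, τ, hgen⟩ := isPrimitiveEmbedding_lamEmbedding_iff.1 hprim
  obtain ⟨B, r, hB, hq, hunit⟩ := extract_gcd b q
  obtain ⟨u, v, huv⟩ := (gcd_isUnit_iff B r).1 hunit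
  have hB0 : B ≠ 0 := right_ne_zero_of_mul (hB ▸ hb)
  have hgp : IsCoprime (gcd b q) p :=
    ⟨β * B + τ * r, σ, by linear_combination hgen - β * hB - τ * hq⟩
  obtain ⟨a, ha0, hab, ha⟩ := exists_isCoprime_modEq hb hB0 (r := v)
    ⟨r, u, by linear_combination huv⟩
  obtain ⟨k, hk⟩ := ha.symm.dvd
  refine ⟨a, ha0, hab, (imagePerp_comp_equivalent i Φ).trans ?_⟩
  rw [hΦ]
  exact imagePerp_lamEmbedding_equivalent_sq hb hB hq (k := k * r - u)
    (by linear_combination r * hk + huv) hgp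

theorem exists_isPrimitiveEmbedding_imagePerp_equivalent_Lam {a : ℤ} (hb : b ≠ 0)
    (hgcd : Int.gcd b (a * c) = Int.gcd b c) :
    ∃ i : (orthSum (Lam b c) W).Isometry (orthSum U (orthSum U W)),
      IsPrimitiveEmbedding i ∧ (imagePerp i).Equivalent (Lam b (-(a ^ 2 * c))) := by
  obtain ⟨B, hB⟩ := Int.gcd_dvd_left b c
  obtain ⟨m, hm⟩ := Int.gcd_dvd_right b c
  obtain ⟨x, y, hxy⟩ : ∃ x y, (Int.gcd b c : ℤ) = b * x + a * c * y :=
    ⟨_, _, hgcd ▸ Int.gcd_eq_gcd_ab b (a * c)⟩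
  generalize (Int.gcd b c : ℤ) = g at hB hm hxy
  obtain ⟨hg, hB0⟩ := mul_ne_zero_iff.1 (hB ▸ hb)
  have hBam : B * x + a * m * y = 1 :=
    mul_left_cancel₀ hg (by linear_combination -hxy - x * hB - a * y * hm)
  obtain ⟨p, -, ⟨σ, β, hpb⟩, hp⟩ := exists_isCoprime_modEq hb hB0 (r := a * m)
    ⟨y, x, by linear_combination hBam⟩
  obtain ⟨l, hl⟩ := hp.symm.dvd
  have hc : c = b * (x * m - l * (m * y)) + p * (g * (m * y)) := by
    rw [hm, hB]
    linear_combination (-g * m) * hBam - g * m * y * hl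
  exact ⟨lamEmbedding W _ p _ hc,
    isPrimitiveEmbedding_lamEmbedding_iff.2 ⟨β, σ, 0, by linear_combination hpb⟩,
    imagePerp_lamEmbedding_equivalent_sq hb hB rfl (k := -x) (by linear_combination hBam)
      ⟨B * β, σ, by linear_combination hpb - β * hB⟩⟩

end Complement

end K3Lattice

open LinearMap (BilinForm) in
open K3Lattice in
theorem proposition3p7_general {P : Type*} [AddCommGroup P] [Module.Free ℤ P]
    [Module.Finite ℤ P] {W : BilinForm ℤ P} (hW : IsEvenUnimodular W) :
    (∀ b c : ℤ, b ≠ 0 →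
      (∀ i : (orthSum (Lam b c) W).Isometry (orthSum U (orthSum U W)), IsPrimitiveEmbedding i →
        ∃ a : ℤ, a ≠ 0 ∧ IsCoprime a b ∧ Isometric (imagePerp i) (Lam b (-(a ^ 2 * c)))) ∧
      (∀ a : ℤ, Int.gcd b (a * c) = Int.gcd b c →
        ∃ i : (orthSum (Lam b c) W).Isometry (orthSum U (orthSum U W)),
          IsPrimitiveEmbedding i ∧ Isometric (imagePerp i) (Lam b (-(a ^ 2 * c))))) ∧
    (∀ b c : ℤ, Isometric (Lam b c) (Lam (-b) c) ∧
      (∀ n : ℤ, Isometric (Lam b c) (Lam b (c - n * b))) ∧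
      (∀ d : ℤ, c * d ≡ 1 [ZMOD b] → Isometric (Lam b c) (Lam b d))) ∧
    (∀ b c d : ℤ, b ≠ 0 → IsCoprime b c →
      (Isometric (Lam b c) (Lam b d) ↔ c ≡ d [ZMOD b] ∨ c * d ≡ 1 [ZMOD b])) := by
  have := hW.isPerfPair
  have hL := isEvenUnimodular_U.orthSum (isEvenUnimodular_U.orthSum hW)
  have hrank : Module.finrank ℤ ((Fin 2 → ℤ) × (Fin 2 → ℤ) × P) = Module.finrank ℤ P + 4 := by
    rw [Module.finrank_prod, Module.finrank_prod, Module.finrank_fin_fun]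
    ring
  simp only [isometric_iff_equivalent]
  exact ⟨fun b c hb => ⟨fun i hi => hi.exists_imagePerp_equivalent_Lam hL hrank hb,
      fun a => exists_isPrimitiveEmbedding_imagePerp_equivalent_Lam hb⟩,
    fun b c => ⟨equivalent_Lam_neg b c, equivalent_Lam_sub_mul b c,
      fun d => equivalent_Lam_of_mul_modEq_one⟩,
    fun b c d => equivalent_Lam_iff⟩

theorem proposition3p7 :
    -- orthogonal complements of primitive embeddings, and the converse
    (∀ b c : ℤ, b ≠ 0 →
      (∀ i : (K3Lattice.Gam b c).Isometry K3Lattice.LamK3, K3Lattice.IsPrimitiveEmbedding i →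
        ∃ a : ℤ, a ≠ 0 ∧ IsCoprime a b ∧
          K3Lattice.Isometric (K3Lattice.imagePerp i) (K3Lattice.Lam b (-(a ^ 2 * c)))) ∧
      (∀ a : ℤ, a ≠ 0 → Int.gcd b (a * c) = Int.gcd b c →
        ∃ i : (K3Lattice.Gam b c).Isometry K3Lattice.LamK3, K3Lattice.IsPrimitiveEmbedding i ∧
          K3Lattice.Isometric (K3Lattice.imagePerp i) (K3Lattice.Lam b (-(a ^ 2 * c))))) ∧
    -- isometries between the lattices `Λ_{b,c}`
    (∀ b c : ℤ, b ≠ 0 →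
      K3Lattice.Isometric (K3Lattice.Lam b c) (K3Lattice.Lam (-b) c) ∧
      (∀ n : ℤ, K3Lattice.Isometric (K3Lattice.Lam b c) (K3Lattice.Lam b (c - n * b))) ∧
      (∀ d : ℤ, c * d ≡ 1 [ZMOD b] →
        K3Lattice.Isometric (K3Lattice.Lam b c) (K3Lattice.Lam b d))) ∧
    -- classification for coprime parameters
    (∀ b c d : ℤ, Int.gcd b c = 1 → 0 ≤ c → c < d → d ≤ b - 1 →
      (K3Lattice.Isometric (K3Lattice.Lam b c) (K3Lattice.Lam b d) ↔ c * d ≡ 1 [ZMOD b])) := by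
  obtain ⟨hperp, hisom, hclass⟩ := proposition3p7_general (K3Lattice.isEvenUnimodular_U.orthSum
    (K3Lattice.isEvenUnimodular_negE8.orthSum K3Lattice.isEvenUnimodular_negE8))
  refine ⟨fun b c hb => ⟨(hperp b c hb).1, fun a _ => (hperp b c hb).2 a⟩,
    fun b c _ => hisom b c, fun b c d hbc h0 hcd hd => ?_⟩
  rw [hclass b c d (by omega) (Int.isCoprime_iff_gcd_eq_one.2 hbc), or_iff_right]
  intro hmod
  rw [Int.ModEq, Int.emod_eq_of_lt h0 (by omega), Int.emod_eq_of_lt (by omega) (by omega)] at hmod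
  exact hcd.ne hmod
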